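/- Let $u\colon\mathbb{C}\to\mathbb{C}$ be an entire function, not identically zero, that solves the Airy equation $u''(z) = z\,u(z)$ for all $z\in\mathbb{C}$. Then $u$ and $u'$, as elements of the field of meromorphic functions on $\mathbb{C}$, are algebraically independent over the subfield $\mathbb{C}(z)$ of rational functions. -/

import Mathlib

open scoped Polynomial

/-- The `ℂ`-algebra of entire functions, with pointwise operations. -/
def Entire : Subalgebra ℂ (ℂ → ℂ) where
  carrier := {f | Differentiable ℂ f}
  mul_mem' hf hg := Differentiable.mul hf hg
  add_mem' hf hg := Differentiable.add hf hg
  algebraMap_mem' c := differentiable_const c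

theorem Entire.mem_iff {f : ℂ → ℂ} : f ∈ Entire ↔ Differentiable ℂ f := Iff.rfl

/-- The ring of entire functions is an integral domain (identity theorem). -/
instance Entire.instIsDomain : IsDomain Entire := by
  have : NoZeroDivisors Entire := by
    refine ⟨fun {f g} h => ?_⟩
    have hf : Differentiable ℂ f.1 := f.2
    have hg : Differentiable ℂ g.1 := g.2
    have h' : ∀ z, f.1 z = 0 ∨ g.1 z = 0 := fun z =>
      mul_eq_zero.mp (congrFun (congrArg Subtype.val h) z)
    by_contra! hne
    obtain ⟨hf0, hg0⟩ := hne
    obtain ⟨z, hz⟩ : ∃ z, f.1 z ≠ 0 := by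
      by_contra! H
      exact hf0 (Subtype.ext (funext H))
    have hev : ∀ᶠ w in nhds z, f.1 w ≠ 0 := hf.continuous.continuousAt.eventually_ne hz
    have hgz : g.1 =ᶠ[nhds z] 0 := hev.mono fun w hw => (h' w).resolve_left hw
    have hg_an : AnalyticOnNhd ℂ g.1 Set.univ := fun w _ => hg.analyticAt w
    exact hg0 (Subtype.ext (hg_an.eq_of_eventuallyEq (fun _ _ => analyticAt_const) hgz))
  exact NoZeroDivisors.to_isDomain Entire

/-- The field of meromorphic functions on `ℂ`, as the field of quotients of entire functions. -/
abbrev MeromorphicField : Type := FractionRing Entire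

/-- A complex polynomial, regarded as the entire function `z ↦ p(z)`. -/
def polyToEntire : ℂ[X] →+* Entire where
  toFun p := ⟨fun z => p.eval z, Entire.mem_iff.mpr p.differentiable⟩
  map_one' := Subtype.ext (funext fun _ => Polynomial.eval_one)
  map_zero' := Subtype.ext (funext fun _ => Polynomial.eval_zero)
  map_mul' _ _ := Subtype.ext (funext fun _ => Polynomial.eval_mul)
  map_add' _ _ := Subtype.ext (funext fun _ => Polynomial.eval_add)

theorem polyToEntire_injective : Function.Injective polyToEntire := fun _ _ h =>
  Polynomial.funext fun z => congrFun (congrArg Subtype.val h) z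

/-- The embedding of the field `ℂ(z)` of rational functions into the field of meromorphic
functions, `p / q ↦ p(z) / q(z)`. -/
noncomputable def ratFuncToMeromorphic : RatFunc ℂ →+* MeromorphicField :=
  RatFunc.liftRingHom ((algebraMap Entire MeromorphicField).comp polyToEntire)
    (nonZeroDivisors_le_comap_nonZeroDivisors_of_injective _
      ((IsFractionRing.injective Entire MeromorphicField).comp polyToEntire_injective))

/-- Meromorphic functions as an extension field of `ℂ(z)`. -/
noncomputable instance MeromorphicField.instAlgebraRatFunc :
    Algebra (RatFunc ℂ) MeromorphicField :=
  ratFuncToMeromorphic.toAlgebra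

/-- An entire function as an element of the field of meromorphic functions. -/
noncomputable def entireToMeromorphic (f : ℂ → ℂ) (hf : Differentiable ℂ f) : MeromorphicField :=
  algebraMap Entire MeromorphicField ⟨f, Entire.mem_iff.mpr hf⟩

/-! Polynomial relations `F(z, u, u') = 0` form a prime ideal of `ℂ[z][X][Y]`, stable under `D = ∂_z
+ Y ∂_X + z X ∂_Y`. By `airy_not_algebraic` it contains no nonzero element of `ℂ[z][X]`: an entire
function algebraic over `ℂ(z)` has polynomial growth, hence a vanishing derivative of some order,
and the Airy recurrence then forces `u = 0`. So a nonzero relation ideal is generated by some `P` of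
positive degree in `Y`, and `D P = A P` (`exists_semiinvariant`).

`natDegree_eq_zero_of_semiinvariant` excludes such a `P`. Put `t = √z`, `w = (Y - tX)/(Y + tX)` and
`s = (Y + tX)/(2t)`; then `D` preserves the degree in `s`. If `n` is the degree of `P` in `X, Y`
jointly, the coefficient `H(w, t)` of `s^n` satisfies a linear first-order equation. For `n > 0`,
its top terms in `t` show that `H` has degree `n/2` in `t` and leading coefficient `c w^(n/2)`. But
on `w = 1`, where `X = 0` and `Y = 2ts`, the power `t^n` divides `H`, so `n ≤ n/2`, a contradiction
(`no_leading_form`). -/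

/-! ### Derivations of iterated polynomial rings -/

/-- Derivations of a commutative ring into itself. -/
abbrev SelfDerivation (A : Type*) [CommRing A] := Derivation ℤ A A

/-- A derivation of `A`, extended to `A[X]` by acting on the coefficients. -/
noncomputable def Derivation.coeffwise {A : Type*} [CommRing A] (d : SelfDerivation A) :
    SelfDerivation A[X] :=
  PolynomialModule.equivPolynomialSelf.compDer d.mapCoeffs

@[simp]
theorem Derivation.coeff_coeffwise {A : Type*} [CommRing A] (d : SelfDerivation A) (p : A[X])
    (i : ℕ) : (d.coeffwise p).coeff i = d (p.coeff i) := rfl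

@[simp]
theorem Derivation.coeffwise_C {A : Type*} [CommRing A] (d : SelfDerivation A) (a : A) :
    d.coeffwise (Polynomial.C a) = Polynomial.C (d a) := by
  ext i
  simp only [Derivation.coeff_coeffwise, Polynomial.coeff_C]
  split_ifs <;> simp

@[simp]
theorem Derivation.coeffwise_X {A : Type*} [CommRing A] (d : SelfDerivation A) :
    d.coeffwise (Polynomial.X : A[X]) = 0 := by
  ext i
  simp only [Derivation.coeff_coeffwise, Polynomial.coeff_X]
  split_ifs <;> simp

/-- The derivative of polynomials, as a derivation over `ℤ`. -/
noncomputable def polyDer (A : Type*) [CommRing A] : SelfDerivation A[X] :=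
  (Polynomial.derivative' (R := A)).restrictScalars ℤ

@[simp]
theorem polyDer_apply {A : Type*} [CommRing A] (p : A[X]) :
    polyDer A p = Polynomial.derivative p := rfl

/-- The elements on which a ring homomorphism intertwines two derivations up to a factor. -/
def intertwiningSubring {R S : Type*} [CommRing R] [CommRing S] (f : R →+* S)
    (D : SelfDerivation R) (δ : SelfDerivation S) (c : S) : Subring R where
  carrier := {x | δ (f x) = c * f (D x)}
  mul_mem' {a b} ha hb := by
    simp only [Set.mem_ofPred_eq] at *
    simp only [map_mul, Derivation.leibniz, ha, hb, smul_eq_mul, map_add]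
    ring
  one_mem' := by simp
  add_mem' {a b} ha hb := by
    simp only [Set.mem_ofPred_eq] at *
    simp only [map_add, ha, hb]
    ring
  zero_mem' := by simp
  neg_mem' {a} ha := by
    simp only [Set.mem_ofPred_eq] at *
    simp only [map_neg, ha]
    ring

theorem mem_intertwiningSubring {R S : Type*} [CommRing R] [CommRing S] {f : R →+* S}
    {D : SelfDerivation R} {δ : SelfDerivation S} {c : S} {x : R} :
    x ∈ intertwiningSubring f D δ c ↔ δ (f x) = c * f (D x) := Iff.rfl

theorem Polynomial.mem_subring_of_C_of_X {A : Type*} [CommRing A] (S : Subring A[X])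
    (hC : ∀ a, Polynomial.C a ∈ S) (hX : Polynomial.X ∈ S) (p : A[X]) : p ∈ S := by
  induction p using Polynomial.induction_on' with
  | add p q hp hq => exact S.add_mem hp hq
  | monomial n a =>
    rw [← Polynomial.C_mul_X_pow_eq_monomial]
    exact S.mul_mem (hC a) (S.pow_mem hX n)

theorem mem_subring_of_generators (S : Subring ℂ[X][X][X])
    (hC : ∀ a : ℂ, Polynomial.C (Polynomial.C (Polynomial.C a)) ∈ S)
    (h1 : Polynomial.C (Polynomial.C Polynomial.X) ∈ S)
    (h2 : Polynomial.C Polynomial.X ∈ S) (h3 : Polynomial.X ∈ S) (p : ℂ[X][X][X]) : p ∈ S := by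
  refine Polynomial.mem_subring_of_C_of_X S (fun a => ?_) h3 p
  let S' : Subring ℂ[X][X] := S.comap (Polynomial.C : ℂ[X][X] →+* ℂ[X][X][X])
  let S'' : Subring ℂ[X] := S'.comap (Polynomial.C : ℂ[X] →+* ℂ[X][X])
  have hS'' : ∀ b, b ∈ S'' := Polynomial.mem_subring_of_C_of_X S'' hC h1
  exact Polynomial.mem_subring_of_C_of_X S' hS'' h2 a

/-! ### The Airy vector field and evaluation at a solution -/

/-- The derivation `∂_z + Y ∂_X + z X ∂_Y` of `ℂ[z][X][Y]`, the vector field of the Airy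
equation. -/
noncomputable def airyDer : SelfDerivation ℂ[X][X][X] :=
  (polyDer ℂ).coeffwise.coeffwise + (Polynomial.X : ℂ[X][X][X]) • (polyDer ℂ[X]).coeffwise +
    (Polynomial.C (Polynomial.C Polynomial.X * Polynomial.X) : ℂ[X][X][X]) • polyDer ℂ[X][X]

theorem airyDer_apply (F : ℂ[X][X][X]) :
    airyDer F = (polyDer ℂ).coeffwise.coeffwise F + Polynomial.X * (polyDer ℂ[X]).coeffwise F +
      Polynomial.C (Polynomial.C Polynomial.X * Polynomial.X) * Polynomial.derivative F := rfl

/-- Differentiation of entire functions. -/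
noncomputable def Entire.der : SelfDerivation Entire :=
  Derivation.restrictScalars ℤ (S := ℂ) <| Derivation.mk'
    { toFun := fun f => ⟨deriv f.1, Entire.mem_iff.mpr (Entire.mem_iff.mp f.2).deriv⟩
      map_add' := fun f g => Subtype.ext (funext fun z =>
        deriv_add ((Entire.mem_iff.mp f.2) z) ((Entire.mem_iff.mp g.2) z))
      map_smul' := fun c f => Subtype.ext (funext fun z =>
        deriv_const_smul c ((Entire.mem_iff.mp f.2) z)) } <| by
    intro f g
    refine Subtype.ext (funext fun z => ?_)
    have := deriv_mul ((Entire.mem_iff.mp f.2) z) ((Entire.mem_iff.mp g.2) z)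
    change deriv (f.1 * g.1) z = f.1 z * deriv g.1 z + g.1 z * deriv f.1 z
    rw [this]
    ring

theorem Entire.der_apply (f : Entire) (z : ℂ) : (Entire.der f).1 z = deriv f.1 z := rfl

/-- Evaluation `F ↦ F(z, f(z), g(z))` of polynomials at a pair of entire functions. -/
noncomputable def evalEntire (f g : Entire) : ℂ[X][X][X] →+* Entire :=
  Polynomial.eval₂RingHom (Polynomial.eval₂RingHom polyToEntire f) g

/-- The elements where the two sides agree form a subring, so constants, `z`, `X` and `Y` suffice.
This makes the relation ideal stable under the vector field. -/
theorem der_evalEntire {f g : Entire} (hf : Entire.der f = g)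
    (hg : Entire.der g = polyToEntire Polynomial.X * f) (F : ℂ[X][X][X]) :
    Entire.der (evalEntire f g F) = evalEntire f g (airyDer F) := by
  have h : ∀ p : ℂ[X], Entire.der (polyToEntire p) = polyToEntire (Polynomial.derivative p) := by
    intro p
    refine Subtype.ext (funext fun z => ?_)
    rw [Entire.der_apply]
    exact p.deriv
  have hF : F ∈ intertwiningSubring (evalEntire f g) airyDer Entire.der 1 := by
    refine mem_subring_of_generators _ (fun a => ?_) ?_ ?_ ?_ F <;>
      refine mem_intertwiningSubring.2 ?_ <;>
      simp [evalEntire, airyDer_apply, h, hf, hg]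
  exact (mem_intertwiningSubring.1 hF).trans (one_mul _)

/-! ### Polynomial growth and transcendence of `u` -/

theorem Polynomial.exists_norm_eval_le (p : ℂ[X]) :
    ∃ (C : ℝ) (k : ℕ), 0 ≤ C ∧ ∀ z, ‖p.eval z‖ ≤ C * (1 + ‖z‖) ^ k := by
  induction p using Polynomial.induction_on' with
  | add p q hp hq =>
    obtain ⟨C, k, hC, h⟩ := hp
    obtain ⟨C', k', hC', h'⟩ := hq
    refine ⟨C + C', k + k', by positivity, fun z => ?_⟩
    have h1 : (1 : ℝ) ≤ 1 + ‖z‖ := by linarith [norm_nonneg z]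
    have e1 : (1 + ‖z‖) ^ k ≤ (1 + ‖z‖) ^ (k + k') := pow_le_pow_right₀ h1 (by omega)
    have e2 : (1 + ‖z‖) ^ k' ≤ (1 + ‖z‖) ^ (k + k') := pow_le_pow_right₀ h1 (by omega)
    rw [Polynomial.eval_add]
    calc _ ≤ ‖p.eval z‖ + ‖q.eval z‖ := norm_add_le _ _
      _ ≤ C * (1 + ‖z‖) ^ (k + k') + C' * (1 + ‖z‖) ^ (k + k') :=
        add_le_add ((h z).trans (by gcongr)) ((h' z).trans (by gcongr))
      _ = _ := by ring
  | monomial n a =>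
    refine ⟨‖a‖, n, norm_nonneg a, fun z => ?_⟩
    rw [Polynomial.eval_monomial, norm_mul, norm_pow]
    gcongr
    linarith

theorem Polynomial.exists_sum_norm_eval_le {ι : Type*} (s : Finset ι) (p : ι → ℂ[X]) :
    ∃ (C : ℝ) (k : ℕ), 0 ≤ C ∧ ∀ z, ∑ i ∈ s, ‖(p i).eval z‖ ≤ C * (1 + ‖z‖) ^ k := by
  choose C k hC h using fun i => (p i).exists_norm_eval_le
  refine ⟨∑ i ∈ s, C i, ∑ i ∈ s, k i, Finset.sum_nonneg fun i _ => hC i, fun z => ?_⟩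
  have h1 : (1 : ℝ) ≤ 1 + ‖z‖ := by linarith [norm_nonneg z]
  rw [Finset.sum_mul]
  refine Finset.sum_le_sum fun i hi => (h i z).trans ?_
  have := hC i
  have := pow_le_pow_right₀ h1 (Finset.single_le_sum (f := k) (fun _ _ => Nat.zero_le _) hi)
  gcongr

theorem Polynomial.exists_le_norm_eval {p : ℂ[X]} (hp : p ≠ 0) :
    ∃ c r : ℝ, 0 < c ∧ ∀ z, r ≤ ‖z‖ → c ≤ ‖p.eval z‖ := by
  by_cases hd : 0 < p.degree
  · have h := p.tendsto_norm_atTop hd (tendsto_norm_cobounded_atTop (E := ℂ))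
    have h' := h.eventually_ge_atTop 1
    rw [← comap_norm_atTop, Filter.eventually_comap] at h'
    obtain ⟨r, hr⟩ := Filter.eventually_atTop.1 h'
    exact ⟨1, r, one_pos, fun z hz => hr _ hz z rfl⟩
  · rw [Polynomial.eq_C_of_degree_le_zero (not_lt.1 hd)] at hp ⊢
    refine ⟨‖p.coeff 0‖, 0, by simpa using hp, fun z _ => by simp⟩

/-- A function that is algebraic over `ℂ(z)` has polynomial growth. -/
theorem exists_norm_le_of_algebraic {u : ℂ → ℂ} {q : ℂ[X][X]} (hq : q ≠ 0)
    (h : ∀ z, (q.map (Polynomial.evalRingHom z)).eval (u z) = 0) :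
    ∃ (C r : ℝ) (k : ℕ), 0 ≤ C ∧ ∀ z, r ≤ ‖z‖ → ‖u z‖ ≤ C * (1 + ‖z‖) ^ k := by
  obtain ⟨c, r, hc, hr⟩ := Polynomial.exists_le_norm_eval (Polynomial.leadingCoeff_ne_zero.2 hq)
  obtain ⟨C, k, hC, hk⟩ :=
    Polynomial.exists_sum_norm_eval_le (Finset.range q.natDegree) q.coeff
  -- The summand `1` covers `‖u z‖ ≤ 1`; `C / c` bounds the lower coefficients over the leading one.
  refine ⟨1 + C / c, r, k, by positivity, fun z hz => ?_⟩
  have h1 : (1 : ℝ) ≤ (1 + ‖z‖) ^ k := one_le_pow₀ (by linarith [norm_nonneg z])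
  have hCc : 0 ≤ C / c := by positivity
  rcases le_or_gt ‖u z‖ 1 with hu | hu
  · nlinarith
  have hsum := h z
  rw [Polynomial.eval_map, Polynomial.eval₂_eq_sum_range, Finset.sum_range_succ] at hsum
  rcases Nat.eq_zero_or_pos q.natDegree with h0 | hpos
  · exfalso
    have := hr z hz
    simp only [h0, Finset.range_zero, Finset.sum_empty, zero_add, pow_zero, mul_one,
      Polynomial.coe_evalRingHom] at hsum
    rw [Polynomial.leadingCoeff, h0, hsum, norm_zero] at this
    linarith
  obtain ⟨m, hm⟩ : ∃ m, q.natDegree = m + 1 := ⟨q.natDegree - 1, by omega⟩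
  -- Isolate the leading term of the relation and divide by `‖u z‖ ^ m`, which dominates the lower
  -- powers because `‖u z‖ > 1`.
  have key : ‖q.leadingCoeff.eval z‖ * ‖u z‖ ≤ C * (1 + ‖z‖) ^ k := by
    refine le_trans ?_ (hk z)
    have hup : 0 < ‖u z‖ ^ m := by positivity
    rw [← mul_le_mul_iff_left₀ hup]
    have e : ‖q.leadingCoeff.eval z‖ * ‖u z‖ * ‖u z‖ ^ m =
        ‖∑ i ∈ Finset.range q.natDegree, (q.coeff i).eval z * u z ^ i‖ := by
      have := eq_neg_of_add_eq_zero_left hsum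
      simp only [Polynomial.coe_evalRingHom] at this
      rw [this, norm_neg, norm_mul, norm_pow, Polynomial.leadingCoeff, mul_assoc, ← pow_succ', hm]
    rw [e, Finset.sum_mul]
    refine (norm_sum_le _ _).trans (Finset.sum_le_sum fun i hi => ?_)
    rw [norm_mul, norm_pow]
    have : i ≤ m := by have := Finset.mem_range.1 hi; omega
    have := pow_le_pow_right₀ hu.le this
    gcongr
  have : c * ‖u z‖ ≤ C * (1 + ‖z‖) ^ k := le_trans (by gcongr; exact hr z hz) key
  have : ‖u z‖ ≤ C / c * (1 + ‖z‖) ^ k := by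
    rw [div_mul_eq_mul_div, le_div_iff₀ hc]; linarith
  linarith

/-- Some iterated derivative of an entire function of polynomial growth vanishes. -/
theorem iteratedDeriv_eq_zero_of_norm_le {u : ℂ → ℂ} (hu : Differentiable ℂ u) {C r : ℝ} {k : ℕ}
    (hC : 0 ≤ C) (h : ∀ z, r ≤ ‖z‖ → ‖u z‖ ≤ C * (1 + ‖z‖) ^ k) (c : ℂ) :
    iteratedDeriv (k + 1) u c = 0 := by
  -- Cauchy's bound on a circle of radius `R`: `(k+1)! C (2R)^k / R^(k+1)`.
  have hlim : Filter.Tendsto (fun R : ℝ => ((k + 1).factorial * (C * 2 ^ k) : ℝ) / R)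
      Filter.atTop (nhds 0) := Filter.tendsto_id.const_div_atTop _
  rw [← norm_le_zero_iff]
  refine ge_of_tendsto hlim ?_
  filter_upwards [Filter.eventually_ge_atTop (1 + ‖c‖), Filter.eventually_ge_atTop (r + ‖c‖)]
    with R hR1 hR2
  have hR : 0 < R := by linarith [norm_nonneg c]
  have hb : ∀ z ∈ Metric.sphere c R, ‖u z‖ ≤ C * (2 * R) ^ k := by
    intro z hz
    have hz' : ‖z - c‖ = R := by simpa using hz
    have h1 : R ≤ ‖z‖ + ‖c‖ := hz' ▸ norm_sub_le z c
    have h2 : ‖z‖ ≤ R + ‖c‖ := by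
      have := norm_add_le (z - c) c
      rwa [sub_add_cancel, hz'] at this
    refine (h z (by linarith)).trans ?_
    gcongr
    linarith
  refine (Complex.norm_iteratedDeriv_le_of_forall_mem_sphere_norm_le (k + 1) hR
    hu.diffContOnCl hb).trans (le_of_eq ?_)
  field_simp
  ring

/-- Leibniz' rule for the derivative of order `k + 1` of `z u`. The nonzero factor `k + 1` lets
vanishing descend from order `k + 1` to order `k`. -/
theorem iteratedDeriv_airy {u : ℂ → ℂ} (hu : Differentiable ℂ u)
    (hode : ∀ z : ℂ, deriv (deriv u) z = z * u z) (k : ℕ) (z : ℂ) :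
    iteratedDeriv (k + 3) u z = z * iteratedDeriv (k + 1) u z + (k + 1) * iteratedDeriv k u z := by
  have hd : ∀ m, Differentiable ℂ (iteratedDeriv m u) := fun m =>
    (hu.contDiff (n := ⊤)).differentiable_iteratedDeriv m (by exact_mod_cast WithTop.coe_lt_top _)
  induction k generalizing z with
  | zero =>
    have h2 : iteratedDeriv 2 u = fun z => z * u z := by
      funext z
      rw [iteratedDeriv_succ, iteratedDeriv_one, hode]
    rw [zero_add, iteratedDeriv_succ, h2]
    rw [deriv_fun_mul differentiableAt_fun_id (hu z), iteratedDeriv_one]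
    simp [add_comm]
  | succ k ih =>
    rw [iteratedDeriv_succ, funext ih]
    rw [deriv_fun_add (differentiableAt_fun_id.fun_mul (hd _ z)) ((hd _ z).const_mul _),
      deriv_fun_mul differentiableAt_fun_id (hd _ z), deriv_const_mul _ (hd _ z),
      ← iteratedDeriv_succ, ← iteratedDeriv_succ]
    push_cast
    simp
    ring

/-- A nonzero entire solution of the Airy equation is transcendental over `ℂ(z)`. -/
theorem airy_not_algebraic {u : ℂ → ℂ} (hu : Differentiable ℂ u)
    (hode : ∀ z : ℂ, deriv (deriv u) z = z * u z) (hne : u ≠ 0) {q : ℂ[X][X]}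
    (h : ∀ z, (q.map (Polynomial.evalRingHom z)).eval (u z) = 0) : q = 0 := by
  by_contra hq
  obtain ⟨C, r, k, hC, hb⟩ := exists_norm_le_of_algebraic hq h
  have hk : ∀ k, iteratedDeriv (k + 1) u = 0 → iteratedDeriv k u = 0 := by
    intro k hk
    funext z
    have h3 : iteratedDeriv (k + 3) u z = 0 := by
      rw [iteratedDeriv_succ, iteratedDeriv_succ, hk]
      simp
    have := iteratedDeriv_airy hu hode k z
    rw [h3, hk] at this
    have hk1 : (k + 1 : ℂ) ≠ 0 := by exact_mod_cast k.succ_ne_zero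
    simpa [hk1] using this
  have : ∀ k, iteratedDeriv k u = 0 → u = 0 := by
    intro k
    induction k with
    | zero => intro h; rwa [iteratedDeriv_zero] at h
    | succ k ih => exact fun h => ih (hk k h)
  exact hne (this (k + 1) (funext fun c => iteratedDeriv_eq_zero_of_norm_le hu hC hb c))

/-! ### The relation ideal is principal -/

/-- Pseudo-division by an element of minimal degree of an ideal of `B[X]`. -/
theorem exists_dvd_C_mul_of_minimal {B : Type*} [CommRing B] [IsDomain B] {I : Ideal B[X]}
    {P : B[X]} (hP : P ∈ I) (hP0 : P ≠ 0)
    (hmin : ∀ G ∈ I, G ≠ 0 → P.natDegree ≤ G.natDegree) (F : B[X]) (hF : F ∈ I) :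
    ∃ c : B, c ≠ 0 ∧ P ∣ Polynomial.C c * F := by
  induction h : F.degree using WellFoundedLT.induction generalizing F with
  | ind d ih =>
    by_cases hF0 : F = 0
    · exact ⟨1, one_ne_zero, by simp [hF0]⟩
    have hlP := Polynomial.leadingCoeff_ne_zero.2 hP0
    have hlF := Polynomial.leadingCoeff_ne_zero.2 hF0
    have hle := hmin F hF hF0
    -- The multiple of `P` that cancels the leading term of `lc(P) F`.
    set Q := Polynomial.C F.leadingCoeff * Polynomial.X ^ (F.natDegree - P.natDegree) * P with hQ
    set F' := Polynomial.C P.leadingCoeff * F with hF'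
    have hF'0 : F' ≠ 0 := mul_ne_zero (Polynomial.C_ne_zero.2 hlP) hF0
    have hdeg : F'.degree = F.degree := Polynomial.degree_C_mul hlP
    have hQdeg : F'.degree = Q.degree := by
      rw [hdeg, hQ, mul_assoc, Polynomial.degree_C_mul hlF, Polynomial.degree_mul,
        Polynomial.degree_X_pow, Polynomial.degree_eq_natDegree hF0,
        Polynomial.degree_eq_natDegree hP0, ← Nat.cast_add, Nat.sub_add_cancel hle]
    have hlt := Polynomial.degree_sub_lt_left hQdeg hF'0 (by
      rw [hF', hQ, Polynomial.leadingCoeff_mul, Polynomial.leadingCoeff_C,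
        Polynomial.leadingCoeff_mul, Polynomial.leadingCoeff_C_mul_X_pow, mul_comm])
    obtain ⟨c, hc, hd⟩ := ih (F' - Q).degree (by rw [← h, ← hdeg]; exact hlt) (F' - Q)
      (I.sub_mem (I.mul_mem_left _ hF) (I.mul_mem_left _ hP)) rfl
    refine ⟨c * P.leadingCoeff, mul_ne_zero hc hlP, ?_⟩
    have e : Polynomial.C (c * P.leadingCoeff) * F =
        Polynomial.C c * (F' - Q) + Polynomial.C c * Q := by
      rw [hF', Polynomial.C_mul]
      ring
    rw [e]
    exact dvd_add hd (Dvd.dvd.mul_left (Dvd.intro_left _ rfl) _)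

/-- A nonzero prime ideal of `B[X]` that contains no nonzero constant is principal. -/
theorem exists_dvd_of_mem_prime_ideal {B : Type*} [CommRing B] [IsDomain B]
    [UniqueFactorizationMonoid B] {I : Ideal B[X]} (hI : I.IsPrime) (hbot : I ≠ ⊥)
    (hC : ∀ b, Polynomial.C b ∈ I → b = 0) :
    ∃ P ∈ I, P.natDegree ≠ 0 ∧ ∀ F ∈ I, P ∣ F := by
  obtain ⟨G₀, hG₀, hG₀0⟩ := Submodule.exists_mem_ne_zero_of_ne_bot hbot
  obtain ⟨G, ⟨hG, hG0⟩, hmin⟩ := exists_minimalFor_of_wellFoundedLT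
    (fun G : B[X] => G ∈ I ∧ G ≠ 0) Polynomial.natDegree ⟨G₀, hG₀, hG₀0⟩
  obtain ⟨f, hf, hfG⟩ := UniqueFactorizationMonoid.exists_prime_factors G hG0
  -- A prime factor of a minimal-degree element still lies in `I`; its primality later turns `P ∣ c
  -- F` into `P ∣ F`.
  obtain ⟨P, hPf, hPI⟩ := (hI.multiset_prod_mem_iff_exists_mem f).1
    ((Ideal.mem_iff_of_associated hfG).2 hG)
  have hPp := hf P hPf
  have hPG : P.natDegree ≤ G.natDegree :=
    Polynomial.natDegree_le_of_dvd ((Multiset.dvd_prod hPf).trans hfG.dvd) hG0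
  have hPmin : ∀ F ∈ I, F ≠ 0 → P.natDegree ≤ F.natDegree := fun F hF hF0 =>
    (le_total G.natDegree F.natDegree).elim hPG.trans fun h => hPG.trans (hmin ⟨hF, hF0⟩ h)
  have hdeg : P.natDegree ≠ 0 := by
    intro h0
    rw [Polynomial.eq_C_of_natDegree_eq_zero h0] at hPI
    apply hPp.ne_zero
    rw [Polynomial.eq_C_of_natDegree_eq_zero h0, hC _ hPI, Polynomial.C_0]
  refine ⟨P, hPI, hdeg, fun F hF => ?_⟩
  obtain ⟨c, hc, hd⟩ := exists_dvd_C_mul_of_minimal hPI hPp.ne_zero hPmin F hF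
  refine (hPp.dvd_or_dvd hd).resolve_left fun h => hdeg ?_
  have := Polynomial.natDegree_le_of_dvd h (Polynomial.C_ne_zero.2 hc)
  rw [Polynomial.natDegree_C] at this
  omega

theorem evalEntire_C_apply (f g : Entire) (q : ℂ[X][X]) (z : ℂ) :
    (evalEntire f g (Polynomial.C q)).1 z = (q.map (Polynomial.evalRingHom z)).eval (f.1 z) := by
  induction q using Polynomial.induction_on' with
  | add p q hp hq =>
    rw [Polynomial.C_add, map_add, Polynomial.map_add, Polynomial.eval_add, ← hp, ← hq]
    rfl
  | monomial n a =>
    simp only [evalEntire, Polynomial.coe_eval₂RingHom, Polynomial.eval₂_C,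
      Polynomial.eval₂_monomial, Polynomial.map_monomial, Polynomial.eval_monomial]
    rfl

/-- If a solution of the Airy equation and its derivative are algebraically dependent, then the
Airy vector field has a semi-invariant polynomial of positive degree in the last variable. -/
theorem exists_semiinvariant {u : ℂ → ℂ} (hu : Differentiable ℂ u)
    (hode : ∀ z : ℂ, deriv (deriv u) z = z * u z) (hne : u ≠ 0) {F : ℂ[X][X][X]} (hF : F ≠ 0)
    (h : evalEntire ⟨u, hu⟩ ⟨deriv u, hu.deriv⟩ F = 0) :
    ∃ P A : ℂ[X][X][X], P.natDegree ≠ 0 ∧ airyDer P = A * P := by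
  set e := evalEntire ⟨u, hu⟩ ⟨deriv u, hu.deriv⟩ with he
  obtain ⟨P, hP, hdeg, hdvd⟩ := exists_dvd_of_mem_prime_ideal (I := RingHom.ker e)
    (RingHom.ker_isPrime e) (fun hb => hF (by rwa [← Ideal.mem_bot, ← hb, RingHom.mem_ker]))
    (fun q hq => airy_not_algebraic hu hode hne fun z => by
      rw [RingHom.mem_ker] at hq
      have := evalEntire_C_apply ⟨u, hu⟩ ⟨deriv u, hu.deriv⟩ q z
      rw [← he, hq] at this
      exact this.symm)
  have hD : airyDer P ∈ RingHom.ker e := by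
    rw [RingHom.mem_ker] at hP ⊢
    rw [he, ← der_evalEntire, ← he, hP, map_zero]
    · rfl
    · refine Subtype.ext (funext fun z => ?_)
      refine (hode z).trans ?_
      change z * u z = (Polynomial.X : ℂ[X]).eval z * u z
      rw [Polynomial.eval_X]
  obtain ⟨A, hA⟩ := hdvd _ hD
  exact ⟨P, A, hdeg, by rw [hA, mul_comm]⟩

/-! ### Coordinates adapted to the square root of `z` -/

set_option maxSynthPendingDepth 5

/-- The derivation `2 t ∂_t + (w² - 1 - 8 t³ w) ∂_w` of `ℂ[w][t]`. -/
noncomputable def rootDer : SelfDerivation ℂ[X][X] :=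
  (2 * Polynomial.X : ℂ[X][X]) • polyDer ℂ[X] +
    (Polynomial.C (Polynomial.X ^ 2 - 1) - 8 * Polynomial.X ^ 3 * Polynomial.C Polynomial.X :
      ℂ[X][X]) • (polyDer ℂ).coeffwise

theorem rootDer_apply (H : ℂ[X][X]) :
    rootDer H = 2 * Polynomial.X * Polynomial.derivative H +
      (Polynomial.C (Polynomial.X ^ 2 - 1) - 8 * Polynomial.X ^ 3 * Polynomial.C Polynomial.X) *
        (polyDer ℂ).coeffwise H := rfl

/-- The logarithmic derivative of `s` under the Airy vector field. -/
noncomputable def rootLogDer : ℂ[X][X] := 4 * Polynomial.X ^ 3 - 1 - Polynomial.C Polynomial.X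

/-- The Airy vector field, multiplied by `4 t²`, in the coordinates `z = t²`, `X = s (1 - w)`,
`Y = t s (1 + w)`. -/
noncomputable def coneDer : SelfDerivation ℂ[X][X][X] :=
  rootDer.coeffwise +
    (Polynomial.C rootLogDer * Polynomial.X : ℂ[X][X][X]) • polyDer ℂ[X][X]

theorem coneDer_apply (F : ℂ[X][X][X]) :
    coneDer F = rootDer.coeffwise F +
      Polynomial.C rootLogDer * Polynomial.X * Polynomial.derivative F := rfl

/-- The substitution `z = t²`, `X = s (1 - w)`, `Y = t s (1 + w)`. -/
noncomputable def coneSubst : ℂ[X][X][X] →+* ℂ[X][X][X] :=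
  Polynomial.eval₂RingHom (S := ℂ[X][X][X])
    (Polynomial.eval₂RingHom (S := ℂ[X][X][X])
      (Polynomial.eval₂RingHom (S := ℂ[X][X][X]) ((Polynomial.C : ℂ[X][X] →+* ℂ[X][X][X]).comp
        ((Polynomial.C : ℂ[X] →+* ℂ[X][X]).comp (Polynomial.C : ℂ →+* ℂ[X])))
        (Polynomial.C (Polynomial.X ^ 2)))
      (Polynomial.X * Polynomial.C (1 - Polynomial.C Polynomial.X)) : ℂ[X][X] →+* ℂ[X][X][X])
    (Polynomial.X * Polynomial.C (Polynomial.X * (1 + Polynomial.C Polynomial.X)))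

/-- Checked on generators. The factor `4 t²` clears the denominators of `D t = 1/(2t)`, `D w` and `D
s / s`. -/
theorem coneDer_coneSubst (F : ℂ[X][X][X]) :
    coneDer (coneSubst F) =
      Polynomial.C (4 * Polynomial.X ^ 2) * coneSubst (airyDer F) := by
  have e2 : (Polynomial.C 2 : ℂ[X][X][X]) = 2 := rfl
  have e4 : (Polynomial.C 4 : ℂ[X][X][X]) = 4 := rfl
  have e8 : (Polynomial.C 8 : ℂ[X][X][X]) = 8 := rfl
  have hF : F ∈ intertwiningSubring coneSubst airyDer coneDer
      (Polynomial.C (4 * Polynomial.X ^ 2)) := by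
    refine mem_subring_of_generators _ (fun a => ?_) ?_ ?_ ?_ F <;>
      refine mem_intertwiningSubring.2 ?_ <;>
      simp [coneSubst, airyDer_apply, coneDer_apply, rootDer_apply, rootLogDer] <;>
      simp only [e2, e4, e8] <;> ring
  exact mem_intertwiningSubring.1 hF

/-- Evaluation of a polynomial in three variables, innermost variable first. -/
noncomputable def evalPoint (a b c : ℂ) : ℂ[X][X][X] →+* ℂ :=
  Polynomial.eval₂RingHom (Polynomial.eval₂RingHom (Polynomial.evalRingHom a) b) c

@[simp]
theorem evalPoint_C_C_X (a b c : ℂ) :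
    evalPoint a b c (Polynomial.C (Polynomial.C Polynomial.X)) = a := by simp [evalPoint]

@[simp]
theorem evalPoint_C_X (a b c : ℂ) : evalPoint a b c (Polynomial.C Polynomial.X) = b := by
  simp [evalPoint]

@[simp]
theorem evalPoint_X (a b c : ℂ) : evalPoint a b c Polynomial.X = c := by simp [evalPoint]

theorem evalPoint_coneSubst (w t s : ℂ) (F : ℂ[X][X][X]) :
    evalPoint w t s (coneSubst F) = evalPoint (t ^ 2) (s * (1 - w)) (s * (t * (1 + w))) F := by
  suffices (evalPoint w t s).comp coneSubst =
      evalPoint (t ^ 2) (s * (1 - w)) (s * (t * (1 + w))) from RingHom.congr_fun this F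
  refine Polynomial.ringHom_ext' (Polynomial.ringHom_ext' (Polynomial.ringHom_ext' ?_ ?_) ?_) ?_
  · ext a
    simp [evalPoint, coneSubst]
  all_goals simp [evalPoint, coneSubst, pow_two]

theorem eq_zero_of_forall_evalPoint {F : ℂ[X][X][X]} (h : ∀ a b c, evalPoint a b c F = 0) :
    F = 0 := by
  have h1 : ∀ a b, F.map (Polynomial.eval₂RingHom (Polynomial.evalRingHom a) b) = 0 :=
    fun a b => Polynomial.funext fun c => by
      rw [Polynomial.eval_map, Polynomial.eval_zero]
      exact h a b c
  have h2 : ∀ a k, (F.coeff k).map (Polynomial.evalRingHom a) = 0 :=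
    fun a k => Polynomial.funext fun b => by
      have := congrArg (fun p => Polynomial.coeff p k) (h1 a b)
      simp only [Polynomial.coeff_map, Polynomial.coeff_zero] at this
      rw [Polynomial.eval_map, Polynomial.eval_zero]
      exact this
  ext k l : 2
  refine Polynomial.funext fun a => ?_
  have := congrArg (fun p => Polynomial.coeff p l) (h2 a k)
  simpa using this

theorem coneSubst_injective : Function.Injective coneSubst := by
  rw [injective_iff_map_eq_zero]
  intro F hF
  -- the substitution is dominant: it reaches all points with `z (y² - z x²) ≠ 0`
  set Z : ℂ[X][X][X] := Polynomial.C (Polynomial.C Polynomial.X) with hZ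
  set G : ℂ[X][X][X] := Z * (Polynomial.X ^ 2 - Z * Polynomial.C Polynomial.X ^ 2) with hG
  have hG0 : G ≠ 0 := by
    intro h
    have := congrArg (evalPoint 1 0 1) h
    simp only [hG, hZ, map_mul, map_sub, map_pow, evalPoint_C_C_X, evalPoint_C_X, evalPoint_X,
      map_zero] at this
    norm_num at this
  suffices G * F = 0 from (mul_eq_zero.1 this).resolve_left hG0
  refine eq_zero_of_forall_evalPoint fun z x y => ?_
  rw [map_mul, mul_eq_zero]
  by_contra! hne
  obtain ⟨hGne, hFne⟩ := hne
  have hGe : evalPoint z x y G = z * (y ^ 2 - z * x ^ 2) := by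
    simp only [hG, hZ, map_mul, map_sub, map_pow, evalPoint_C_C_X, evalPoint_C_X, evalPoint_X]
  rw [hGe] at hGne
  have hz : z ≠ 0 := left_ne_zero_of_mul hGne
  obtain ⟨t, rfl⟩ : ∃ t, z = t ^ 2 := by
    obtain ⟨t, ht⟩ := IsAlgClosed.exists_pow_nat_eq z (n := 2) (by norm_num)
    exact ⟨t, ht.symm⟩
  have ht : t ≠ 0 := fun h => hz (by simp [h])
  have hs : y + t * x ≠ 0 := fun h => right_ne_zero_of_mul hGne (by
    linear_combination (y - t * x) * h)
  apply hFne
  -- With `q = y + tx`, the preimage is `s = q/(2t)`, `w = (y - tx)/q`.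
  obtain ⟨q, rfl⟩ : ∃ q, y = q - t * x := ⟨y + t * x, by ring⟩
  have hq : q ≠ 0 := by simpa using hs
  have hx : q / (2 * t) * (1 - (q - 2 * t * x) / q) = x := by
    field_simp
    ring
  have hy : q / (2 * t) * (t * (1 + (q - 2 * t * x) / q)) = q - t * x := by
    field_simp
    ring
  have := evalPoint_coneSubst ((q - 2 * t * x) / q) t (q / (2 * t)) F
  rw [hF, map_zero, hx, hy] at this
  exact this.symm

/-- At `s = 0` only the constant term in `X` and `Y` survives. -/
theorem coeff_zero_coneSubst (F : ℂ[X][X][X]) :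
    (coneSubst F).coeff 0 =
      (Polynomial.expand ℂ 2 ((F.coeff 0).coeff 0)).map Polynomial.C := by
  suffices Polynomial.constantCoeff.comp coneSubst =
      ((Polynomial.mapRingHom Polynomial.C).comp (Polynomial.expand ℂ 2).toRingHom).comp
        (Polynomial.constantCoeff.comp Polynomial.constantCoeff) by
    simpa using RingHom.congr_fun this F
  refine Polynomial.ringHom_ext' (Polynomial.ringHom_ext' (Polynomial.ringHom_ext' ?_ ?_) ?_) ?_
  · ext a
    simp [coneSubst]
  all_goals simp [coneSubst, pow_two]

theorem coneSubst_C_C (p : ℂ[X]) :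
    coneSubst (Polynomial.C (Polynomial.C p)) =
      Polynomial.C ((Polynomial.expand ℂ 2 p).map Polynomial.C) := by
  suffices coneSubst.comp (Polynomial.C.comp Polynomial.C) =
      Polynomial.C.comp
        ((Polynomial.mapRingHom Polynomial.C).comp (Polynomial.expand ℂ 2).toRingHom) by
    simpa using RingHom.congr_fun this p
  refine Polynomial.ringHom_ext' ?_ ?_
  · ext a
    simp [coneSubst]
  · simp [coneSubst]

/-- On the line `w = 1` the coefficient of `s^n` is divisible by `t^n`. -/
theorem X_pow_dvd_coeff_coneSubst (F : ℂ[X][X][X]) (n : ℕ) :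
    Polynomial.X ^ n ∣ ((coneSubst F).coeff n).map (Polynomial.evalRingHom 1) := by
  let κ : ℂ[X][X] →+* ℂ[X] :=
    ((Polynomial.expand ℂ 2).toRingHom).comp Polynomial.constantCoeff
  have h : (Polynomial.mapRingHom (Polynomial.mapRingHom (Polynomial.evalRingHom 1))).comp
      coneSubst = (Polynomial.compRingHom (Polynomial.C (2 * Polynomial.X) * Polynomial.X)).comp
        (Polynomial.mapRingHom κ) := by
    refine Polynomial.ringHom_ext' (Polynomial.ringHom_ext' (Polynomial.ringHom_ext' ?_ ?_) ?_) ?_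
    · ext a
      simp [coneSubst, κ]
    · simp [coneSubst, κ]
    · simp [coneSubst, κ]
    · have e2 : (Polynomial.C 2 : ℂ[X][X]) = 2 := rfl
      simp [coneSubst, κ, e2]
      ring
  have h' := congrArg (fun p => Polynomial.coeff p n) (RingHom.congr_fun h F)
  simp only [RingHom.comp_apply, Polynomial.coe_mapRingHom, Polynomial.coeff_map,
    Polynomial.coe_compRingHom, Polynomial.comp_C_mul_X_coeff] at h'
  rw [h', mul_pow]
  exact Dvd.dvd.mul_left (Dvd.intro_left _ rfl) _

/-! ### Excluding semi-invariants -/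

/-- No nonzero polynomial satisfies the equation of the leading coefficient in `s` of a
semi-invariant of positive degree. -/
theorem no_leading_form {H : ℂ[X][X]} {n : ℕ} {A : ℂ[X]} (hn : n ≠ 0) (hH : H ≠ 0)
    (hdvd : Polynomial.X ^ n ∣ H.map (Polynomial.evalRingHom 1))
    (h : rootDer H + (n : ℂ[X][X]) * rootLogDer * H =
      4 * Polynomial.X ^ 2 * (Polynomial.expand ℂ 2 A).map Polynomial.C * H) : False := by
  set d := H.natDegree with hd
  set a : ℂ[X][X] := (Polynomial.expand ℂ 2 A).map Polynomial.C with ha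
  -- `L` collects the terms carrying `t³`, and `M` those without `t` apart from `2 t ∂_t H`. `L`
  -- scales `w^m` by `4n - 8m`.
  set L : ℂ[X][X] := Polynomial.C (Polynomial.C (4 * n : ℂ)) * H -
    Polynomial.C (Polynomial.C (8 : ℂ) * Polynomial.X) * (polyDer ℂ).coeffwise H with hL
  set M : ℂ[X][X] := Polynomial.C (Polynomial.X ^ 2 - 1) * (polyDer ℂ).coeffwise H -
    Polynomial.C (Polynomial.C (n : ℂ) * (1 + Polynomial.X)) * H with hM
  have hcoef : ∀ k, d < k → H.coeff k = 0 := fun k => Polynomial.coeff_eq_zero_of_natDegree_lt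
  have hLc : ∀ k m, (L.coeff k).coeff m = (4 * n - 8 * m) * (H.coeff k).coeff m := by
    intro k m
    rw [hL]
    simp only [Polynomial.coeff_sub, Polynomial.coeff_C_mul, Derivation.coeff_coeffwise,
      polyDer_apply, mul_assoc]
    cases m with
    | zero =>
      simp
      ring
    | succ m =>
      rw [Polynomial.coeff_X_mul, Polynomial.coeff_derivative]
      push_cast
      ring
  have h' : Polynomial.X ^ 3 * L + (2 * (Polynomial.X * Polynomial.derivative H) + M) =
      4 * (Polynomial.X ^ 2 * (a * H)) := by
    rw [rootDer_apply, rootLogDer] at h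
    have e4 : (Polynomial.C (Polynomial.C 4) : ℂ[X][X]) = 4 := rfl
    have e8 : (Polynomial.C (Polynomial.C 8) : ℂ[X][X]) = 8 := rfl
    have en : (Polynomial.C (Polynomial.C (n : ℂ)) : ℂ[X][X]) = (n : ℂ[X][X]) := by
      rw [Polynomial.C_eq_natCast, Polynomial.C_eq_natCast]
    rw [hM, hL]
    simp only [Polynomial.C_mul, Polynomial.C_add, Polynomial.C_1, e4, e8, en] at h ⊢
    linear_combination h
  have h3 : ∀ k, (Polynomial.X ^ 3 * L).coeff k + (2 * (k * H.coeff k) + M.coeff k) =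
      4 * (Polynomial.X ^ 2 * (a * H)).coeff k := by
    intro k
    have := congrArg (fun p => Polynomial.coeff p k) h'
    have e2 : (2 : ℂ[X][X]) = Polynomial.C 2 := rfl
    have e4 : (4 : ℂ[X][X]) = Polynomial.C 4 := rfl
    simp only [Polynomial.coeff_add, e2, e4, Polynomial.coeff_C_mul] at this
    rw [← this]
    congr 3
    cases k with
    | zero => simp
    | succ k =>
      rw [Polynomial.coeff_X_mul, Polynomial.coeff_derivative]
      push_cast
      ring
  have hM0 : ∀ k, d < k → M.coeff k = 0 := by
    intro k hk
    rw [hM]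
    simp only [Polynomial.coeff_sub, Polynomial.coeff_C_mul, Derivation.coeff_coeffwise,
      hcoef k hk, map_zero, mul_zero, sub_zero]
  have hL0 : ∀ k, d < k → L.coeff k = 0 := by
    intro k hk
    ext m
    rw [hLc, hcoef k hk]
    simp
  -- `A` is constant
  have hA : A.natDegree = 0 := by
    by_contra hA
    have hA0 : A ≠ 0 := fun h => hA (by simp [h])
    have hadeg : a.natDegree = A.natDegree * 2 := by
      rw [ha, Polynomial.natDegree_map_eq_of_injective Polynomial.C_injective,
        Polynomial.natDegree_expand]
    have ha0 : a ≠ 0 := fun h => hA (by rw [h, Polynomial.natDegree_zero] at hadeg; omega)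
    -- For nonconstant `A` the right side has `t`-degree at least `d + 4`, the left at most `d + 3`.
    have hk := h3 (A.natDegree * 2 + d + 2)
    rw [hcoef _ (by omega), hM0 _ (by omega), show A.natDegree * 2 + d + 2 =
      (A.natDegree * 2 + d - 1) + 3 by omega, Polynomial.coeff_X_pow_mul, hL0 _ (by omega),
      show (A.natDegree * 2 + d - 1) + 3 = A.natDegree * 2 + d + 2 by omega,
      Polynomial.coeff_X_pow_mul, ← hadeg, hd, ← Polynomial.natDegree_mul ha0 hH] at hk
    have h0 : (a * H).leadingCoeff = 0 := by simpa using hk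
    exact mul_ne_zero ha0 hH (Polynomial.leadingCoeff_eq_zero.1 h0)
  obtain ⟨α, rfl⟩ : ∃ α, A = Polynomial.C α := ⟨_, Polynomial.eq_C_of_natDegree_eq_zero hA⟩
  have haH : ∀ k, (a * H).coeff k = Polynomial.C α * H.coeff k := by
    intro k
    rw [ha, Polynomial.expand_C, Polynomial.map_C, Polynomial.coeff_C_mul]
  have hHd : H.coeff d ≠ 0 := Polynomial.leadingCoeff_ne_zero.2 hH
  have hLd : L.coeff d = 0 := by
    have hk := h3 (d + 3)
    rw [hcoef _ (by omega), hM0 _ (by omega), Polynomial.coeff_X_pow_mul,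
      show d + 3 = (d + 1) + 2 by omega, Polynomial.coeff_X_pow_mul, haH, hcoef _ (by omega)] at hk
    simpa using hk
  obtain ⟨m, hm⟩ : ∃ m, (H.coeff d).coeff m ≠ 0 := by
    by_contra! hall
    exact hHd (Polynomial.ext (by simpa using hall))
  have hsupp : ∀ j, (H.coeff d).coeff j ≠ 0 → n = 2 * j := by
    intro j hj
    have := hLc d j
    rw [hLd, Polynomial.coeff_zero, eq_comm, mul_eq_zero, or_iff_left hj] at this
    have h2 : (n : ℂ) = 2 * j := by linear_combination this / 4
    exact_mod_cast h2
  have hnm := hsupp m hm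
  -- Since `n = 2m`, the term `t³ L` drops out of every `w^m` coefficient. Degree `d + 2` in `t`
  -- then gives `α = 0`, and degree `d` gives `n = 2d`.
  have hLm : ∀ k, ((Polynomial.X ^ 3 * L).coeff k).coeff m = 0 := by
    intro k
    rw [Polynomial.coeff_X_pow_mul']
    split_ifs
    · rw [hLc, hnm]
      push_cast
      ring
    · simp
  have hmono : ∀ j, j ≠ m → (H.coeff d).coeff j = 0 := by
    intro j hj
    by_contra hne
    have := hsupp j hne
    omega
  have hα : α = 0 := by
    have hk := congrArg (fun p => Polynomial.coeff p m) (h3 (d + 2))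
    simp only [Polynomial.coeff_add, hLm] at hk
    rw [hcoef _ (by omega), hM0 _ (by omega), Polynomial.coeff_X_pow_mul, haH,
      show (4 : ℂ[X]) = Polynomial.C 4 from rfl, Polynomial.coeff_C_mul,
      Polynomial.coeff_C_mul] at hk
    simpa [hm] using hk
  have hMd : (M.coeff d).coeff m = - (n * (H.coeff d).coeff m) := by
    rw [hM]
    simp only [Polynomial.coeff_sub, Polynomial.coeff_C_mul, Derivation.coeff_coeffwise,
      polyDer_apply, mul_assoc, sub_mul, add_mul, one_mul, Polynomial.coeff_add,
      Polynomial.coeff_X_pow_mul', Polynomial.coeff_derivative]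
    rw [hmono (m + 1) (by omega)]
    have e1 : (Polynomial.X * H.coeff d).coeff m = 0 := by
      cases m with
      | zero => simp
      | succ m => rw [Polynomial.coeff_X_mul, hmono m (by omega)]
    have e2 : (if 2 ≤ m then (H.coeff d).coeff (m - 2 + 1) * ((m - 2 : ℕ) + 1 : ℂ) else 0) = 0 := by
      split_ifs with h2
      · rw [hmono _ (by omega), zero_mul]
      · rfl
    rw [e1, e2]
    ring
  have hnd : n = 2 * d := by
    have ha0 : a = 0 := by rw [ha, hα]; simp
    have hk := congrArg (fun p => Polynomial.coeff p m) (h3 d)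
    simp only [Polynomial.coeff_add, hLm, hMd, ha0] at hk
    have e : (2 * (d * H.coeff d)).coeff m = 2 * d * (H.coeff d).coeff m := by
      rw [← mul_assoc, show (2 : ℂ[X]) * d = Polynomial.C (2 * d : ℂ) by
        rw [Polynomial.C_mul, Polynomial.C_eq_natCast]; rfl,
        Polynomial.coeff_C_mul]
    rw [e] at hk
    have h2 : (n : ℂ) = 2 * d := by
      apply mul_right_cancel₀ hm
      simp only [zero_mul, mul_zero, Polynomial.coeff_zero] at hk
      linear_combination -hk
    exact_mod_cast h2
  -- At `w = 1` the coefficient of `t^d` is that of the single monomial `w^m`, hence nonzero.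
  have hle : n ≤ d := by
    by_contra! hlt
    have h1 := Polynomial.X_pow_dvd_iff.1 hdvd d hlt
    rw [Polynomial.coeff_map, Polynomial.coe_evalRingHom, Polynomial.eval_eq_sum_range] at h1
    simp only [one_pow, mul_one] at h1
    rw [Finset.sum_eq_single m (fun j _ hj => hmono j hj) (fun hj => by
      rw [Finset.mem_range, not_lt] at hj
      exact Polynomial.coeff_eq_zero_of_natDegree_lt (by omega))] at h1
    exact hm h1
  omega

/-- Every semi-invariant polynomial of the Airy vector field has degree `0` in `Y`. -/
theorem natDegree_eq_zero_of_semiinvariant {P A : ℂ[X][X][X]} (h : airyDer P = A * P) :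
    P.natDegree = 0 := by
  by_cases hP0 : P = 0
  · simp [hP0]
  set Q := coneSubst P with hQ
  have hQ0 : Q ≠ 0 := fun h0 => hP0 (coneSubst_injective (by rw [← hQ, h0, map_zero]))
  set n := Q.natDegree with hn
  have h4 : (Polynomial.C (4 * Polynomial.X ^ 2) : ℂ[X][X][X]) ≠ 0 := by
    rw [Polynomial.C_ne_zero]
    exact mul_ne_zero (by norm_num) (pow_ne_zero _ Polynomial.X_ne_zero)
  have heq : coneDer Q = Polynomial.C (4 * Polynomial.X ^ 2) * (coneSubst A * Q) := by
    rw [hQ, coneDer_coneSubst, h, RingHom.map_mul coneSubst]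
  have hcoef : ∀ k, (coneDer Q).coeff k = rootDer (Q.coeff k) + (k : ℂ[X][X]) * rootLogDer * Q.coeff k := by
    intro k
    rw [coneDer_apply, Polynomial.coeff_add, Derivation.coeff_coeffwise, mul_assoc,
      Polynomial.coeff_C_mul]
    cases k with
    | zero => simp
    | succ k =>
      rw [Polynomial.coeff_X_mul, Polynomial.coeff_derivative]
      push_cast
      ring
  have hdeg : (coneDer Q).natDegree ≤ n := by
    rw [Polynomial.natDegree_le_iff_coeff_eq_zero]
    intro k hk
    rw [hcoef, Polynomial.coeff_eq_zero_of_natDegree_lt hk]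
    simp
  -- The derivation does not raise the degree in `s`, so the cofactor depends on `z` alone.
  have hA : (coneSubst A).natDegree = 0 := by
    by_cases hA0 : coneSubst A = 0
    · simp [hA0]
    rw [heq, Polynomial.natDegree_C_mul (Polynomial.C_ne_zero.1 h4),
      Polynomial.natDegree_mul hA0 hQ0] at hdeg
    omega
  have hAC := Polynomial.eq_C_of_natDegree_eq_zero hA
  rw [coeff_zero_coneSubst] at hAC
  by_cases hn0 : n = 0
  · have hQC := Polynomial.eq_C_of_natDegree_eq_zero hn0
    have hPC : P = Polynomial.C (Polynomial.C ((P.coeff 0).coeff 0)) := by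
      apply coneSubst_injective
      rw [coneSubst_C_C, ← coeff_zero_coneSubst, ← hQ]
      exact hQC
    rw [hPC, Polynomial.natDegree_C]
  · exfalso
    refine no_leading_form (H := Q.coeff n) hn0 (Polynomial.leadingCoeff_ne_zero.2 hQ0)
      (X_pow_dvd_coeff_coneSubst P n) (A := (A.coeff 0).coeff 0) ?_
    have := congrArg (fun p => Polynomial.coeff p n) heq
    simp only [hcoef, Polynomial.coeff_C_mul] at this
    rw [hAC, Polynomial.coeff_C_mul] at this
    rw [this]
    ring

/-! ### Passage to meromorphic functions over `ℂ(z)` -/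

theorem algebraMap_ratFunc_meromorphic (p : ℂ[X]) :
    algebraMap (RatFunc ℂ) MeromorphicField (algebraMap ℂ[X] (RatFunc ℂ) p) =
      algebraMap Entire MeromorphicField (polyToEntire p) :=
  RatFunc.liftRingHom_algebraMap _ _ p

/-- Polynomials in two variables are polynomials in the second variable over polynomials in the
first one. -/
theorem MvPolynomial.exists_finTwo_ringEquiv (B : Type*) [CommRing B] :
    ∃ φ : MvPolynomial (Fin 2) B ≃+* B[X][X],
      (∀ b, φ (MvPolynomial.C b) = Polynomial.C (Polynomial.C b)) ∧
      φ (MvPolynomial.X 0) = Polynomial.C Polynomial.X ∧ φ (MvPolynomial.X 1) = Polynomial.X := by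
  refine ⟨((MvPolynomial.renameEquiv B (Equiv.swap (0 : Fin 2) 1)).toRingEquiv.trans
      (MvPolynomial.finSuccEquiv B 1).toRingEquiv).trans
      (Polynomial.mapEquiv (MvPolynomial.uniqueAlgEquiv B (Fin 1)).toRingEquiv),
    fun b => ?_, ?_, ?_⟩
  · simp [MvPolynomial.finSuccEquiv_apply]
  · have h1 : MvPolynomial.finSuccEquiv B 1 (MvPolynomial.X 1) =
        Polynomial.C (MvPolynomial.X 0) := MvPolynomial.finSuccEquiv_X_succ (j := 0)
    simp [h1]
  · simp [MvPolynomial.finSuccEquiv_apply]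

theorem corollary1 (u : ℂ → ℂ) (hu : Differentiable ℂ u)
    (hode : ∀ z : ℂ, deriv (deriv u) z = z * u z) (hne : u ≠ 0) :
    AlgebraicIndependent (RatFunc ℂ)
      ![entireToMeromorphic u hu, entireToMeromorphic (deriv u) hu.deriv] := by
  let : Algebra ℂ[X] MeromorphicField :=
    ((algebraMap Entire MeromorphicField).comp polyToEntire).toAlgebra
  have : IsScalarTower ℂ[X] (RatFunc ℂ) MeromorphicField :=
    IsScalarTower.of_algebraMap_eq fun p => (algebraMap_ratFunc_meromorphic p).symm
  have : Algebra.IsAlgebraic ℂ[X] (RatFunc ℂ) :=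
    IsLocalization.isAlgebraic _ (nonZeroDivisors ℂ[X])
  -- Clearing denominators: `ℂ(z)` is algebraic over `ℂ[z]`, so independence over `ℂ[z]` suffices.
  suffices h : AlgebraicIndependent ℂ[X]
      ![entireToMeromorphic u hu, entireToMeromorphic (deriv u) hu.deriv] from
    h.extendScalars _
  rw [algebraicIndependent_iff]
  intro p hp
  obtain ⟨φ, hφC, hφ0, hφ1⟩ := MvPolynomial.exists_finTwo_ringEquiv ℂ[X]
  have key : ((algebraMap Entire MeromorphicField).comp
      (evalEntire ⟨u, hu⟩ ⟨deriv u, hu.deriv⟩)).comp φ.toRingHom =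
      (MvPolynomial.aeval (R := ℂ[X])
        ![entireToMeromorphic u hu, entireToMeromorphic (deriv u) hu.deriv]).toRingHom := by
    refine MvPolynomial.ringHom_ext (fun q => ?_) (fun i => ?_)
    · simp [hφC, evalEntire]
      rfl
    · fin_cases i
      · simp [hφ0, evalEntire]
        rfl
      · simp [hφ1, evalEntire]
        rfl
  have hp' := RingHom.congr_fun key p
  by_contra hp0
  have hF : φ p ≠ 0 := fun h => hp0 (φ.injective (by rw [h, map_zero]))
  obtain ⟨P, A, hdeg, hPA⟩ := exists_semiinvariant hu hode hne hF
    (IsFractionRing.injective Entire MeromorphicField (by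
      rw [map_zero]
      exact hp'.trans hp))
  exact hdeg (natDegree_eq_zero_of_semiinvariant hPA)
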